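/- **Good graphs.** All graphs are finite and simple. A bowtie consists of two triangles sharing exactly one vertex; the chimney $C_n$ ($n\ge 2$) consists of $n$ triangles over one common edge. A graph $G=(V,E)$ is *good* if it contains no bowtie as a (not necessarily induced) subgraph and every vertex lies in a copy of some $C_n$, $n\ge2$, or of $K_4$. Let $E_0$ be the set of edges of $G$ lying in a triangle and $E_1=E\setminus E_0$. A vertex is *central* if it lies in at least two triangles; the *centre* $c(v)$ of a vertex $v$ is the set of central vertices in the component of $(V,E_0)$ containing $v$. It is either the common edge of a chimney or a copy of $K_4$. **Ordered good graphs.** An *ordered good graph* is a good graph with a linear order such that: every centre $c(v)$ is an interval; the vertices of centres of chimneys precede the vertices in copies of $K_4$; central vertices precede non-central ones; the non-central vertices with a given centre form an interval; and these intervals are ordered as their centres are. **Languages and lifts.** For distinct vertices $u,v$ of an ordered good graph $G$, let $t(u,v)$ be the isomorphism type of the structure that $(V,E_0,E_1,\le)$ induces on $\{u,v\}\cup c(u)\cup c(v)$, rooted in $(u,v)$. The language $L_2$ consists of unary symbols $L,R,1,2,3,4$, binary symbols $E_0,E_1,\le$, and a binary symbol $R^t$ for each type $t$ that occurs in this way.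 In the lift $L_2(G)$, the symbols $E_0,E_1,\le$ have their given meaning, $R^{t}$ holds for $(u,v)$ iff $u<v$ and $t=t(u,v)$, the relations $L$ and $R$ consist of the first and of the second vertices of centres of chimneys, and the relations $1,2,3,4$ of the first, second, third and fourth vertices of copies of $K_4$. The language $L^\bullet$ is $L_2$ without the symbols $R,2,3,4$, and the *reduction* $L_2(G)^\bullet$ is the $L^\bullet$-structure that $L_2(G)$ induces on the vertices in none of $R,2,3,4$. **The class.** An $L^\bullet$-structure is *complete* if any two distinct vertices lie together in a tuple of some relation other than $\le$. Let $\mathcal T$ be the set of all complete $L^\bullet$-structures on at most three vertices that do not embed (as induced substructures) into $L_2(G)^\bullet$ for any ordered good graph $G$. An $L^\bullet$-structure is *admissibly ordered* if $\le$ is a linear order in which the vertices in $L$ precede those in $1$, and the vertices in $L$ or $1$ precede the vertices in neither. Let $\mathrm{Forb}_{L^\bullet}(\mathcal T)$ be the class of all finite admissibly ordered $L^\bullet$-structures that contain no structure from $\mathcal T$ as an induced substructure; its members need not be complete. **Theorem.** $\mathrm{Forb}_{L^\bullet}(\mathcal T)$ is a Ramsey class: for all $\mathbf A,\mathbf B\in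 \mathrm{Forb}_{L^\bullet}(\mathcal T)$ and every integer $k\ge 1$ there is $\mathbf C\in\mathrm{Forb}_{L^\bullet}(\mathcal T)$ with $\mathbf C\to(\mathbf B)^{\mathbf A}_k$, that is, for every colouring with $k$ colours of the induced substructures of $\mathbf C$ isomorphic to $\mathbf A$ there is an induced substructure $\widetilde{\mathbf B}$ of $\mathbf C$ isomorphic to $\mathbf B$ such that all substructures of $\widetilde{\mathbf B}$ isomorphic to $\mathbf A$ have the same colour. In particular, there is such a $\mathbf C$ with $\mathbf C\to(\mathbf B)^{\mathbf A}_2$. -/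

import Mathlib

open FirstOrder

namespace BowtieFree

/-! ### Good bowtie-free graphs and their centres -/

section Graph

variable {V : Type}

/-- The bowtie: two triangles `0 1 2` and `0 3 4` sharing the single vertex `0`. -/
def bowtie : SimpleGraph (Fin 5) :=
  SimpleGraph.fromEdgeSet {s(0, 1), s(0, 2), s(1, 2), s(0, 3), s(0, 4), s(3, 4)}

/-- The chimney graph with `n` triangles over one common edge: the common edge joins the two
vertices on the left, and each of the `n` vertices on the right is joined to both of them. -/
def chimney (n : ℕ) : SimpleGraph (Fin 2 ⊕ Fin n) :=
  SimpleGraph.fromRel fun x _ => x.isLeft = true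

/-- The vertex `v` of `G` lies in a copy of `H`, i.e. in a not necessarily induced subgraph of `G`
isomorphic to `H`. -/
def InCopy {W : Type} (H : SimpleGraph W) (G : SimpleGraph V) (v : V) : Prop :=
  ∃ f : SimpleGraph.Copy H G, v ∈ Set.range f

/-- Good graphs: no bowtie as a not necessarily induced subgraph, and every vertex lies in a copy
of a chimney (with at least two triangles) or of the complete graph on four vertices. -/
def IsGood (G : SimpleGraph V) : Prop :=
  bowtie.Free G ∧
    ∀ v, (∃ n, 2 ≤ n ∧ InCopy (chimney n) G v) ∨ InCopy (⊤ : SimpleGraph (Fin 4)) G v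

/-- Edges of type 0: the edges that lie in a triangle. They form the graph `(V, E₀)`. -/
def edgeZero (G : SimpleGraph V) : SimpleGraph V where
  Adj u v := G.Adj u v ∧ ∃ w, G.Adj u w ∧ G.Adj v w
  symm := ⟨fun _ _ ⟨h, w, h₁, h₂⟩ => ⟨h.symm, w, h₂, h₁⟩⟩
  loopless := ⟨fun _ h => h.1.ne rfl⟩

/-- Edges of type 1: all the remaining edges. -/
def edgeOne (G : SimpleGraph V) : SimpleGraph V := G \ edgeZero G

/-- Central vertices: those contained in two or more triangles. -/
def IsCentral (G : SimpleGraph V) (v : V) : Prop :=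
  ∃ s t : Finset V, s ≠ t ∧ G.IsNClique 3 s ∧ G.IsNClique 3 t ∧ v ∈ s ∧ v ∈ t

/-- The centre `c(v)` of a vertex: the central vertices in its connected component in `(V, E₀)`. -/
def centre (G : SimpleGraph V) (v : V) : Set V :=
  {w | IsCentral G w ∧ (edgeZero G).Reachable v w}

/-- Admissible orderings of a good graph. -/
structure IsAdmissible [LinearOrder V] (G : SimpleGraph V) : Prop where
  /-- every vertex centre is an interval -/
  interval : ∀ v, (centre G v).OrdConnected
  /-- centres of chimneys come before vertices in copies of `K₄` -/
  chimney_before_k4 : ∀ u v, IsCentral G u → ¬ InCopy (⊤ : SimpleGraph (Fin 4)) G u →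
    InCopy (⊤ : SimpleGraph (Fin 4)) G v → u < v
  /-- central vertices come before non-central ones -/
  central_before : ∀ u v, IsCentral G u → ¬ IsCentral G v → u < v
  /-- the non-central vertices with a given centre form an interval -/
  fibre_interval : ∀ u v w, ¬ IsCentral G u → ¬ IsCentral G w → centre G u = centre G w →
    u ≤ v → v ≤ w → centre G v = centre G u
  /-- the order of these intervals follows the order of the centres -/
  fibre_order : ∀ u v, ¬ IsCentral G u → ¬ IsCentral G v →
    (∀ a ∈ centre G u, ∀ b ∈ centre G v, a < b) → u < v

end Graph

/-- Finite good graphs with an admissible linear ordering. -/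
structure OrderedGoodGraph where
  V : Type
  finite : Finite V
  order : LinearOrder V
  graph : SimpleGraph V
  good : IsGood graph
  admissible : IsAdmissible graph

attribute [instance] OrderedGoodGraph.finite OrderedGoodGraph.order

namespace OrderedGoodGraph

variable (G : OrderedGoodGraph)

/-- The first vertex of the centre of a chimney (relation `L`). -/
def IsLeft (u : G.V) : Prop := ∃ v, u < v ∧ centre G.graph u = {u, v}

/-- The second vertex of the centre of a chimney (relation `R`). -/
def IsRight (v : G.V) : Prop := ∃ u, u < v ∧ centre G.graph v = {u, v}

/-- The vertex `v` is the vertex number `i` (in increasing order, from `0` to `3`) of a copy of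
`K₄`. -/
def IsK4Vertex (i : Fin 4) (v : G.V) : Prop :=
  ∃ f : Fin 4 → G.V, StrictMono f ∧ (∀ j k, j ≠ k → G.graph.Adj (f j) (f k)) ∧ f i = v

/-- The set `{u, v} ∪ c(u) ∪ c(v)`. -/
def pairSpan (u v : G.V) : Set G.V := {u, v} ∪ centre G.graph u ∪ centre G.graph v

end OrderedGoodGraph

/-- A finite ordered structure with two binary relations and two roots. It lives on `Fin size` with
its natural order; every isomorphism class of such structures has exactly one representative of
this form. -/
structure RootedStr where
  size : ℕ
  zero : Fin size → Fin size → Prop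
  one : Fin size → Fin size → Prop
  root₁ : Fin size
  root₂ : Fin size

/-- `t` is the isomorphism type `t(u, v)` of the ordered structure (with edges of type 0 and 1)
that `G` induces on `{u, v} ∪ c(u) ∪ c(v)`, rooted in `(u, v)`. -/
def HasType (G : OrderedGoodGraph) (u v : G.V) (t : RootedStr) : Prop :=
  ∃ f : Fin t.size ≃o G.pairSpan u v,
    (∀ i j, t.zero i j ↔ (edgeZero G.graph).Adj (f i) (f j)) ∧
    (∀ i j, t.one i j ↔ (edgeOne G.graph).Adj (f i) (f j)) ∧
    (f t.root₁ : G.V) = u ∧ (f t.root₂ : G.V) = v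

/-- The isomorphism types `t(u, v)` that occur in ordered good graphs. -/
def PairType : Type :=
  {t : RootedStr // ∃ (G : OrderedGoodGraph) (u v : G.V), u ≠ v ∧ HasType G u v t}

/-! ### The lift of an ordered good graph and its reduction -/

/-- Relation symbols of the language `L₂`. -/
inductive LiftRel : ℕ → Type
  | left : LiftRel 1
  | right : LiftRel 1
  | k4 (i : Fin 4) : LiftRel 1
  | le : LiftRel 2
  | edge₀ : LiftRel 2
  | edge₁ : LiftRel 2
  | typ (t : PairType) : LiftRel 2

/-- The language `L₂`. -/
def liftLang : Language := ⟨fun _ => Empty, LiftRel⟩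

/-- The lift `L₂(G)` of an ordered good graph `G`. -/
instance liftStr (G : OrderedGoodGraph) : liftLang.Structure G.V where
  funMap := fun f => Empty.elim f
  RelMap := fun {_} r => match r with
    | LiftRel.left => fun x => G.IsLeft (x 0)
    | LiftRel.right => fun x => G.IsRight (x 0)
    | LiftRel.k4 i => fun x => G.IsK4Vertex i (x 0)
    | LiftRel.le => fun x => x 0 ≤ x 1
    | LiftRel.edge₀ => fun x => (edgeZero G.graph).Adj (x 0) (x 1)
    | LiftRel.edge₁ => fun x => (edgeOne G.graph).Adj (x 0) (x 1)
    | LiftRel.typ t => fun x => x 0 < x 1 ∧ HasType G (x 0) (x 1) t.1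

/-- Relation symbols of the language `L•`: those of `L₂` without the unary relations `R`, `2`, `3`,
`4`, whose vertices are removed in reductions. -/
inductive RedRel : ℕ → Type
  | left : RedRel 1
  | first : RedRel 1
  | le : RedRel 2
  | edge₀ : RedRel 2
  | edge₁ : RedRel 2
  | typ (t : PairType) : RedRel 2

/-- The language `L•`. -/
def redLang : Language := ⟨fun _ => Empty, RedRel⟩

/-- The symbols of `L•` as symbols of `L₂`. -/
def RedRel.toLift : {n : ℕ} → RedRel n → LiftRel n
  | _, .left => .left
  | _, .first => .k4 0
  | _, .le => .le
  | _, .edge₀ => .edge₀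
  | _, .edge₁ => .edge₁
  | _, .typ t => .typ t

/-- The vertices that stay in the reduction: those not in the relations `R`, `2`, `3`, `4`. -/
def Kept (G : OrderedGoodGraph) : Type :=
  {v : G.V // ¬ G.IsRight v ∧ ∀ i : Fin 4, i ≠ 0 → ¬ G.IsK4Vertex i v}

/-- The reduction `L₂(G)•`: what `L₂(G)` induces on the vertices that are kept, as an
`L•`-structure. -/
instance reductionStr (G : OrderedGoodGraph) : redLang.Structure (Kept G) where
  funMap := fun f => Empty.elim f
  RelMap := fun {n} r x =>
    Language.Structure.RelMap (L := liftLang) (M := G.V) (n := n) (RedRel.toLift r)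
      (fun i => (x i).1)

/-! ### Classes of `L•`-structures -/

/-- `L•`-structures (with a vertex set in `Type`). -/
abbrev RedStr : Type 1 := CategoryTheory.Bundled.{0} redLang.Structure

/-- The vertex `x` is in the relation `L`. -/
def InLeft (A : RedStr) (x : A) : Prop :=
  Language.Structure.RelMap (L := redLang) (n := 1) RedRel.left ![x]

/-- The vertex `x` is in the relation `1`. -/
def InFirst (A : RedStr) (x : A) : Prop :=
  Language.Structure.RelMap (L := redLang) (n := 1) RedRel.first ![x]

/-- The pair `(x, y)` is in the binary relation `r`. -/
def BinRel (A : RedStr) (r : RedRel 2) (x y : A) : Prop :=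
  Language.Structure.RelMap (L := redLang) (n := 2) r ![x, y]

/-- The relation `≤` of `A` is a linear order. -/
structure IsOrdered (A : RedStr) : Prop where
  refl : ∀ x : A, BinRel A .le x x
  antisymm : ∀ x y : A, BinRel A .le x y → BinRel A .le y x → x = y
  trans : ∀ x y z : A, BinRel A .le x y → BinRel A .le y z → BinRel A .le x z
  total : ∀ x y : A, BinRel A .le x y ∨ BinRel A .le y x

/-- The strict order of `A`. -/
def Before (A : RedStr) (x y : A) : Prop := BinRel A .le x y ∧ x ≠ y

/-- Admissible orderings of `L•`-structures: vertices in `L`, then vertices in `1`, then the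
vertices in neither (the non-central ones). -/
structure IsAdmissiblyOrdered (A : RedStr) : Prop where
  ordered : IsOrdered A
  left_first : ∀ x y : A, InLeft A x → InFirst A y → Before A x y
  left_rest : ∀ x y : A, InLeft A x → ¬ InLeft A y → ¬ InFirst A y → Before A x y
  first_rest : ∀ x y : A, InFirst A x → ¬ InLeft A y → ¬ InFirst A y → Before A x y

/-- Complete structures: any two distinct vertices are together in a tuple of some relation other
than the order. -/
def IsComplete (A : RedStr) : Prop :=
  ∀ x y : A, x ≠ y → ∃ r : RedRel 2, r ≠ .le ∧ (BinRel A r x y ∨ BinRel A r y x)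

/-- `A` is (isomorphic to) an induced substructure of the reduction of the lift of an ordered good
graph. -/
def IsReducedLift (A : RedStr) : Prop :=
  ∃ G : OrderedGoodGraph, Nonempty (A ↪[redLang] Kept G)

/-- The set `𝒯` of the complete `L•`-structures on at most three vertices that are not substructures
of a reduced lift. -/
def triangles : Set RedStr :=
  {F | Finite F ∧ Nat.card F ≤ 3 ∧ IsComplete F ∧ ¬ IsReducedLift F}

/-- `A` contains no structure from `S` as an induced substructure. -/
def Avoids (S : Set RedStr) (A : RedStr) : Prop :=
  ∀ F ∈ S, IsEmpty (F ↪[redLang] A)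

/-- The class `Forb_{L•}(S)`: finite, admissibly ordered structures that contain no structure
from `S` as an induced substructure. -/
def forb (S : Set RedStr) : Set RedStr :=
  {A | Finite A ∧ IsAdmissiblyOrdered A ∧ Avoids S A}

/-- The class `Forb_{L•}(S)` is the same for every set `S` of complete structures on at most three
vertices such that the complete ordered structures avoiding `S` are exactly the substructures of
reduced lifts. -/
theorem forb_eq_forb_triangles (S : Set RedStr)
    (hS : ∀ F ∈ S, Finite F ∧ Nat.card F ≤ 3 ∧ IsComplete F)
    (hdesc : ∀ A : RedStr, Finite A → IsOrdered A → IsComplete A → (Avoids S A ↔ IsReducedLift A)) :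
    forb S = forb triangles := by
  have key : ∀ {F A : RedStr} (f : F ↪[redLang] A), IsOrdered A → IsOrdered F := by
    intro F A f h
    have hr : ∀ x y : F, BinRel F .le x y ↔ BinRel A .le (f x) (f y) := by
      intro x y
      have := f.map_rel (n := 2) RedRel.le ![x, y]
      rw [BinRel, BinRel, ← this]
      congr!
      ext i
      fin_cases i <;> rfl
    refine ⟨fun x => (hr _ _).2 (h.refl _), fun x y h₁ h₂ => ?_, fun x y z h₁ h₂ => ?_,
      fun x y => ?_⟩
    · exact f.injective (h.antisymm _ _ ((hr _ _).1 h₁) ((hr _ _).1 h₂))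
    · exact (hr _ _).2 (h.trans _ _ _ ((hr _ _).1 h₁) ((hr _ _).1 h₂))
    · simpa only [hr] using h.total (f x) (f y)
  ext A
  refine and_congr_right fun _ => and_congr_right fun hA => ⟨fun h F hF => ⟨fun f => ?_⟩,
    fun h F hF => ⟨fun f => ?_⟩⟩
  · obtain ⟨hfin, -, hc, hn⟩ := hF
    refine hn ((hdesc F hfin (key f hA.ordered) hc).1 fun F' hF' => ⟨fun g => ?_⟩)
    exact (h F' hF').false (f.comp g)
  · obtain ⟨hfin, h3, hc⟩ := hS F hF
    refine (h F ⟨hfin, h3, hc, fun hr => ?_⟩).false f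
    exact ((hdesc F hfin (key f hA.ordered) hc).2 hr F hF).false
      (Language.Embedding.refl redLang F)

/-! ### Ramsey classes -/

/-- `C ⟶ (B)^A_k`: for every colouring with `k` colours of the substructures of `C` isomorphic to
`A` there is a substructure of `C` isomorphic to `B` all of whose substructures isomorphic to `A`
have the same colour. -/
def Arrows (C B A : RedStr) (k : ℕ) : Prop :=
  ∀ χ : {A' : redLang.Substructure C // Nonempty (A ≃[redLang] A')} → Fin k,
    ∃ B' : redLang.Substructure C, Nonempty (B ≃[redLang] B') ∧
      ∃ c : Fin k, ∀ A', A'.1 ≤ B' → χ A' = c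

/-- Ramsey classes. -/
def IsRamseyClass (K : Set RedStr) : Prop :=
  ∀ A ∈ K, ∀ B ∈ K, ∀ k : ℕ, 1 ≤ k → ∃ C ∈ K, Arrows C B A k

end BowtieFree

/-! The argument is the partite construction of Nešetřil and Rödl. The structures in `triangles` are
complete, so an embedded one is a clique of related pairs. It therefore suffices to build a
structure with the required arrow in which every nonempty clique embeds, order included, in B: it
can then contain nothing that B avoids.

A structure is encoded as a system of types of pairs (`pairRel`), with `none` for distinct vertices
sharing no relation other than the order; the order is carried separately by a height function.
Given a system D over a base and a place a of A in the base, a Hales–Jewett power of D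
(`exists_power`) contains, for every colouring, a copy of D whose copies of A over a have one
colour. Iterating over all places (`exists_iterated_power`) makes the colour of a copy of A depend
on its projection only, and an arrow in the base then finishes (`exists_arrow`).

This runs twice. Over the base `Fin n` from Ramsey's theorem it yields a system with the arrow but
without control of cliques. Over that system as new base, all relations are lifted from the base,
and `IsCovered.power` keeps each clique injectively above a single copy of B.

Pairs in no common copy of B may violate the block order (`L`, then `1`, then the rest). Sorting by
block first and by height second repairs this without changing the order inside copies of B. -/

namespace BowtieFree

/-! ### The finite Ramsey theorem -/

section Ramsey

variable {κ : Type}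

/-- The induction step of Ramsey's theorem: a large set contains a large subset in which the colour
of an `(m + 1)`-set depends only on its least element. -/
theorem exists_endHomogeneous [Nonempty κ] {m : ℕ}
    (hm : ∀ l : ℕ, ∃ n : ℕ, ∀ X : Finset ℕ, n ≤ X.card → ∀ χ : Finset ℕ → κ,
      ∃ Y ⊆ X, Y.card = l ∧ ∃ c, ∀ s ⊆ Y, s.card = m → χ s = c) (l : ℕ) :
    ∃ n : ℕ, ∀ X : Finset ℕ, n ≤ X.card → ∀ χ : Finset ℕ → κ,
      ∃ Y ⊆ X, Y.card = l ∧ ∃ f : ℕ → κ, ∀ x ∈ Y, ∀ s ⊆ Y, s.card = m → (∀ y ∈ s, x < y) →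
        χ (insert x s) = f x := by
  induction l with
  | zero =>
    refine ⟨0, fun X _ χ => ⟨∅, by simp, rfl, fun _ => Classical.arbitrary κ, by simp⟩⟩
  | succ l ih =>
    obtain ⟨n, hn⟩ := ih
    obtain ⟨N, hN⟩ := hm n
    refine ⟨N + 1, fun X hX χ => ?_⟩
    have hne : X.Nonempty := Finset.card_pos.1 (by omega)
    set x := X.min' hne with hx
    have hxX : x ∈ X := X.min'_mem hne
    -- All `m`-subsets of `H` get the same colour once the minimum `x` is added, so any
    -- end-homogeneous subset of `H` may be extended by `x`.
    obtain ⟨H, hH, hHn, c, hc⟩ := hN (X.erase x)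
      (by rw [Finset.card_erase_of_mem hxX]; omega) (fun s => χ (insert x s))
    obtain ⟨Y, hY, hYl, f, hf⟩ := hn H hHn.ge χ
    have hlt : ∀ y ∈ Y, x < y := fun y hy =>
      Finset.min'_lt_of_mem_erase_min' X hne (hH (hY hy))
    have hxY : x ∉ Y := fun h => (hlt x h).false
    refine ⟨insert x Y, ?_, by rw [Finset.card_insert_of_notMem hxY, hYl],
      fun y => if y = x then c else f y, ?_⟩
    · exact Finset.insert_subset hxX ((hY.trans hH).trans (Finset.erase_subset _ _))
    · intro y hy s hs hsm hys
      have hxs : x ∉ s := by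
        intro hxs
        rcases Finset.mem_insert.1 hy with rfl | hy
        · exact (hys _ hxs).false
        · exact lt_asymm (hys _ hxs) (hlt _ hy)
      have hsY : s ⊆ Y := (Finset.subset_insert_iff_of_notMem hxs).1 hs
      by_cases hyx : y = x
      · subst hyx
        simpa using hc s (hsY.trans hY) hsm
      · simpa [hyx] using hf y (Finset.mem_of_mem_insert_of_ne hy hyx) s hsY hsm hys

/-- Once the colour of a set depends only on its minimum, the pigeonhole principle on minima leaves
`l` of `Fintype.card κ * l` points with one colour. -/
theorem finite_ramsey (κ : Type) [Finite κ] [Nonempty κ] (m l : ℕ) :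
    ∃ n : ℕ, ∀ X : Finset ℕ, n ≤ X.card → ∀ χ : Finset ℕ → κ,
      ∃ Y ⊆ X, Y.card = l ∧ ∃ c, ∀ s ⊆ Y, s.card = m → χ s = c := by
  classical
  induction m generalizing l with
  | zero =>
    refine ⟨l, fun X hX χ => ?_⟩
    obtain ⟨Y, hY, hl⟩ := Finset.exists_subset_card_eq hX
    exact ⟨Y, hY, hl, χ ∅, fun s _ hs => by rw [Finset.card_eq_zero.1 hs]⟩
  | succ m ih =>
    have := Fintype.ofFinite κ
    obtain ⟨n, hn⟩ := exists_endHomogeneous ih (Fintype.card κ * l)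
    refine ⟨n, fun X hX χ => ?_⟩
    obtain ⟨Y, hY, hYl, f, hf⟩ := hn X hX χ
    obtain ⟨c, -, hc⟩ := Finset.exists_le_card_fiber_of_mul_le_card_of_maps_to
      (s := Y) (t := Finset.univ) (f := f) (fun _ _ => Finset.mem_univ _) Finset.univ_nonempty
      (n := l) (by rw [hYl, Finset.card_univ])
    obtain ⟨Z, hZ, hZl⟩ := Finset.exists_subset_card_eq hc
    refine ⟨Z, (hZ.trans (Finset.filter_subset _ _)).trans hY, hZl, c, fun s hs hsm => ?_⟩
    have hne : s.Nonempty := Finset.card_pos.1 (by omega)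
    have hmem := s.min'_mem hne
    have hsY : s ⊆ Y := hs.trans (hZ.trans (Finset.filter_subset _ _))
    rw [← Finset.insert_erase hmem, hf _ (hsY hmem) _ ((Finset.erase_subset _ _).trans hsY)
      (by rw [Finset.card_erase_of_mem hmem]; omega)
      (fun y hy => Finset.min'_lt_of_mem_erase_min' s hne hy)]
    exact (Finset.mem_filter.1 (hZ (hs hmem))).2

/-- Ramsey's theorem for strictly monotone maps between finite linear orders. -/
theorem ramsey_strictMono (κ : Type) [Finite κ] [Nonempty κ] (A B : Type) [Finite A] [Finite B]
    [LinearOrder A] [LinearOrder B] :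
    ∃ n : ℕ, ∀ χ : (A → Fin n) → κ, ∃ b : B → Fin n, StrictMono b ∧
      ∃ c, ∀ e : A → B, StrictMono e → χ (b ∘ e) = c := by
  classical
  have := Fintype.ofFinite A
  have := Fintype.ofFinite B
  obtain ⟨n, hn⟩ := finite_ramsey κ (Fintype.card A) (Fintype.card B)
  refine ⟨n, fun χ => ?_⟩
  -- A strictly monotone map is determined by its range, so colouring maps amounts to colouring
  -- sets; all other sets get a default colour.
  obtain ⟨Y, hY, hYB, c, hc⟩ := hn (Finset.range n) (by simp) fun s =>
    if h : ∃ a : A → Fin n, StrictMono a ∧ Finset.univ.image (fun x => (a x : ℕ)) = s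
    then χ h.choose else Classical.arbitrary κ
  let i : B ≃o Y := (Fintype.orderIsoFinOfCardEq B rfl).symm.trans (Y.orderIsoOfFin hYB)
  have hlt : ∀ x : B, (i x : ℕ) < n := fun x => Finset.mem_range.1 (hY (i x).2)
  have hb : StrictMono fun x : B => (⟨i x, hlt x⟩ : Fin n) := fun x y h => i.strictMono h
  refine ⟨fun x => ⟨i x, hlt x⟩, hb, c, fun e he => ?_⟩
  set a : A → Fin n := (fun x : B => (⟨i x, hlt x⟩ : Fin n)) ∘ e with ha
  have hamono : StrictMono a := hb.comp he
  have hinj : Function.Injective fun x => (a x : ℕ) :=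
    Fin.val_injective.comp hamono.injective
  have key := hc (Finset.univ.image fun x => (a x : ℕ)) (by
    intro z hz
    obtain ⟨x, -, rfl⟩ := Finset.mem_image.1 hz
    exact (i (e x)).2) (by rw [Finset.card_image_of_injective _ hinj, Finset.card_univ])
  have h : ∃ a' : A → Fin n, StrictMono a' ∧
      Finset.univ.image (fun x => (a' x : ℕ)) = Finset.univ.image fun x => (a x : ℕ) :=
    ⟨a, hamono, rfl⟩
  rw [dif_pos h] at key
  have heq : h.choose = a := by
    refine (h.choose_spec.1.range_inj hamono).1 (Set.ext fun z => ?_)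
    have := Finset.ext_iff.1 h.choose_spec.2 z
    simpa [Fin.val_inj] using this
  rwa [heq] at key

end Ramsey

/-! ### The partite construction -/

section Partite

/-- A finite system partitioned by `proj` into parts indexed by `N`, in which every pair of vertices
has a type in `T`, or none. -/
structure PartiteSystem (N T : Type) where
  V : Type
  finite : Finite V
  proj : V → N
  rel : V → V → Option T

attribute [instance] PartiteSystem.finite

namespace PartiteSystem

variable {N T A B : Type}

/-- `f` embeds the system `D` into `D'`, respecting parts. -/
structure IsEmbedding (D D' : PartiteSystem N T) (f : D.V → D'.V) : Prop where
  proj : ∀ x, D'.proj (f x) = D.proj x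
  rel : ∀ x y, D'.rel (f x) (f y) = D.rel x y

/-- `e` is a copy in `D` of the structure `relA`, lying transversally over `a`. -/
def IsOver (D : PartiteSystem N T) (relA : A → A → Option T) (a : A → N) (e : A → D.V) : Prop :=
  (∀ x, D.proj (e x) = a x) ∧ ∀ x y, D.rel (e x) (e y) = relA x y

open Classical in
/-- The value of `w` that differs from `t` if there is one, and `t` otherwise. -/
noncomputable def select {ι T : Type} (t : T) (w : ι → T) : T :=
  if h : ∃ j, w j ≠ t then w h.choose else t

/-- On a combinatorial line the fixed coordinates show the type `t` prescribed by A and the active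
ones the type `s` of a pair in D; the selected value has to be `s`. -/
theorem select_eq {ι T : Type} {t s : T} {w : ι → T} (hw : ∀ j, w j = t ∨ w j = s)
    (hs : ∃ j, w j = s) : select t w = s := by
  unfold select
  split_ifs with h
  · exact (hw _).resolve_left h.choose_spec
  · push Not at h
    obtain ⟨j, hj⟩ := hs
    rw [← hj, h j]

theorem select_eq_self {ι T : Type} {t : T} {w : ι → T} (hw : ∀ j, w j = t) : select t w = t := by
  unfold select
  rw [dif_neg (by simpa using hw)]

/-! ### Hales–Jewett powers of partite systems -/

section Power

variable (D : PartiteSystem N T) (relA : A → A → Option T) (a : A → N) (ι : Type)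

/-- The vertices of the power: functions into a part over `a`, and for every combinatorial line
a copy of the vertices of `D` that are not over `a`. -/
abbrev PowerVertex : Type :=
  {p : A × (ι → D.V) // ∀ j, D.proj (p.2 j) = a p.1} ⊕
    (Combinatorics.Line {e : A → D.V // D.IsOver relA a e} ι × {v : D.V // ¬ ∃ x, a x = D.proj v})

variable {ι}

open Classical in
/-- The copy of `D` in its power that belongs to a combinatorial line. -/
noncomputable def lineMap (l : Combinatorics.Line {e : A → D.V // D.IsOver relA a e} ι) (v : D.V) :
    D.PowerVertex relA a ι :=
  if h : ∃ x, a x = D.proj v then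
    .inl ⟨(h.choose, fun j => (l.idxFun j).elim v fun e => e.1 h.choose), fun j => by
      cases hj : l.idxFun j with
      | none => simpa [hj] using h.choose_spec.symm
      | some e => simpa [hj] using e.2.1 _⟩
  else .inr (l, ⟨v, h⟩)

variable {D relA a}

theorem lineMap_of_eq (ha : Function.Injective a)
    (l : Combinatorics.Line {e : A → D.V // D.IsOver relA a e} ι) {v : D.V} {x : A}
    (h : D.proj v = a x) :
    D.lineMap relA a l v = .inl ⟨(x, fun j => (l.idxFun j).elim v fun e => e.1 x), fun j => by
      cases hj : l.idxFun j with
      | none => simpa [hj] using h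
      | some e => simpa [hj] using e.2.1 _⟩ := by
  have h' : ∃ x, a x = D.proj v := ⟨x, h.symm⟩
  have hx : h'.choose = x := ha (h'.choose_spec.trans h)
  rw [lineMap, dif_pos h']
  congr!

theorem lineMap_of_not (l : Combinatorics.Line {e : A → D.V // D.IsOver relA a e} ι) {v : D.V}
    (h : ¬ ∃ x, a x = D.proj v) : D.lineMap relA a l v = .inr (l, ⟨v, h⟩) := by
  rw [lineMap, dif_neg h]

/-- A line has an active coordinate, and there the vertex itself can be read off. -/
theorem lineMap_injective (ha : Function.Injective a)
    (l : Combinatorics.Line {e : A → D.V // D.IsOver relA a e} ι) :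
    Function.Injective (D.lineMap relA a l) := by
  intro v w hvw
  by_cases hv : ∃ x, a x = D.proj v <;> by_cases hw : ∃ x, a x = D.proj w
  · obtain ⟨x, hx⟩ := hv
    obtain ⟨y, hy⟩ := hw
    rw [lineMap_of_eq ha l hx.symm, lineMap_of_eq ha l hy.symm] at hvw
    obtain ⟨j, hj⟩ := l.proper
    have := congrFun (Prod.ext_iff.1 (Subtype.ext_iff.1 (Sum.inl.inj hvw))).2 j
    simpa [hj] using this
  · obtain ⟨x, hx⟩ := hv
    rw [lineMap_of_eq ha l hx.symm, lineMap_of_not l hw] at hvw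
    cases hvw
  · obtain ⟨y, hy⟩ := hw
    rw [lineMap_of_not l hv, lineMap_of_eq ha l hy.symm] at hvw
    cases hvw
  · rw [lineMap_of_not l hv, lineMap_of_not l hw] at hvw
    simpa using hvw

/-- A vertex outside of the parts over `a` determines the line. -/
theorem eq_of_lineMap_eq_inr {l l' : Combinatorics.Line {e : A → D.V // D.IsOver relA a e} ι}
    {v : D.V} {q} (h : D.lineMap relA a l v = .inr (l', q)) : l = l' := by
  by_cases hv : ∃ x, a x = D.proj v
  · rw [lineMap, dif_pos hv] at h
    cases h
  · rw [lineMap_of_not l hv] at h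
    exact (Prod.ext_iff.1 (Sum.inr.inj h)).1

variable (D relA a ι)

open Classical in
/-- The types of pairs in the power that involve a vertex outside of the parts over `a`. -/
noncomputable def lineRel (u w : D.PowerVertex relA a ι) : Option T :=
  if h : ∃ q : Combinatorics.Line {e : A → D.V // D.IsOver relA a e} ι × D.V × D.V,
      u = D.lineMap relA a q.1 q.2.1 ∧ w = D.lineMap relA a q.1 q.2.2
  then D.rel h.choose.2.1 h.choose.2.2 else none

/-- The types of pairs in the power. -/
noncomputable def powerRel : D.PowerVertex relA a ι → D.PowerVertex relA a ι → Option T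
  | .inl p, .inl q => select (relA p.1.1 q.1.1) fun j => D.rel (p.1.2 j) (q.1.2 j)
  | u, w => D.lineRel relA a ι u w

/-- The power of the parts of `D` over `a`, amalgamated with a copy of `D` over every combinatorial
line. -/
noncomputable def power [Finite A] [Finite ι] : PartiteSystem N T where
  V := D.PowerVertex relA a ι
  finite := by
    have : Finite (Combinatorics.Line {e : A → D.V // D.IsOver relA a e} ι) :=
      Finite.of_injective (fun l => l.idxFun) fun l l' h => by
        cases l; cases l'; cases h; rfl
    infer_instance
  proj := Sum.elim (fun p => a p.1.1) fun q => D.proj q.2.1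
  rel := D.powerRel relA a ι

variable {D relA a ι}

/-- The vertex outside the parts over `a` determines the line, and injectivity on that line
determines both vertices; so the choice in `lineRel` is harmless. -/
theorem lineRel_lineMap (ha : Function.Injective a)
    (l : Combinatorics.Line {e : A → D.V // D.IsOver relA a e} ι) {v w : D.V}
    (h : (¬ ∃ x, a x = D.proj v) ∨ ¬ ∃ x, a x = D.proj w) :
    D.lineRel relA a ι (D.lineMap relA a l v) (D.lineMap relA a l w) = D.rel v w := by
  have hex : ∃ q : Combinatorics.Line {e : A → D.V // D.IsOver relA a e} ι × D.V × D.V,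
      D.lineMap relA a l v = D.lineMap relA a q.1 q.2.1 ∧
        D.lineMap relA a l w = D.lineMap relA a q.1 q.2.2 := ⟨(l, v, w), rfl, rfl⟩
  rw [lineRel, dif_pos hex]
  obtain ⟨h₁, h₂⟩ := hex.choose_spec
  have hl : hex.choose.1 = l := by
    rcases h with h | h
    · exact eq_of_lineMap_eq_inr (h₁.symm.trans (lineMap_of_not l h))
    · exact eq_of_lineMap_eq_inr (h₂.symm.trans (lineMap_of_not l h))
  rw [hl] at h₁ h₂
  rw [← lineMap_injective ha l h₁, ← lineMap_injective ha l h₂]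

theorem isEmbedding_lineMap [Finite A] [Finite ι] (ha : Function.Injective a)
    (l : Combinatorics.Line {e : A → D.V // D.IsOver relA a e} ι) :
    D.IsEmbedding (D.power relA a ι) (D.lineMap relA a l) where
  proj v := by
    by_cases hv : ∃ x, a x = D.proj v
    · obtain ⟨x, hx⟩ := hv
      rw [lineMap_of_eq ha l hx.symm]
      exact hx
    · rw [lineMap_of_not l hv]
      rfl
  rel v w := by
    by_cases hv : ∃ x, a x = D.proj v
    · by_cases hw : ∃ x, a x = D.proj w
      · obtain ⟨x, hx⟩ := hv
        obtain ⟨y, hy⟩ := hw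
        rw [lineMap_of_eq ha l hx.symm, lineMap_of_eq ha l hy.symm]
        refine select_eq (fun j => ?_) ?_
        · cases hj : l.idxFun j with
          | none => right; simp [hj]
          | some e => left; simpa [hj] using e.2.2 _ _
        · obtain ⟨j, hj⟩ := l.proper
          exact ⟨j, by simp [hj]⟩
      · rw [← lineRel_lineMap ha l (.inr hw)]
        conv_lhs => rw [lineMap_of_not l hw]
        conv_rhs => rw [lineMap_of_not l hw]
        change D.powerRel relA a ι _ _ = _
        rw [powerRel]
        simp
    · rw [← lineRel_lineMap ha l (.inl hv), lineMap_of_not l hv]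
      rfl

end Power

/-! ### The partite lemma and its iteration -/

variable [Finite A]

/-- The partite lemma, together with the amalgamation. -/
theorem exists_power (κ : Type) [Finite κ] (D : PartiteSystem N T) (relA : A → A → Option T)
    {a : A → N} (ha : Function.Injective a) :
    ∃ (ι : Type) (_ : Finite ι), ∀ χ : (A → (D.power relA a ι).V) → κ,
      ∃ f, Nonempty ι ∧ D.IsEmbedding (D.power relA a ι) f ∧
        ∃ c, ∀ e, D.IsOver relA a e → χ (f ∘ e) = c := by
  obtain ⟨ι, _, hι⟩ :=
    Combinatorics.Line.exists_mono_in_high_dimension {e : A → D.V // D.IsOver relA a e} κ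
  refine ⟨ι, inferInstance, fun χ => ?_⟩
  -- A word whose letters are copies of A over `a` is read coordinatewise as a map from A to the
  -- power. The point of the line `l` at the letter `e` becomes `lineMap` composed with `e`.
  obtain ⟨l, c, hc⟩ := hι fun w => χ fun x => .inl ⟨(x, fun j => (w j).1 x), fun j => (w j).2.1 x⟩
  refine ⟨D.lineMap relA a l, ⟨l.proper.choose⟩, isEmbedding_lineMap ha l, c, fun e he => ?_⟩
  rw [← hc ⟨e, he⟩]
  congr 1
  funext x
  refine (lineMap_of_eq ha l (he.1 x)).trans ?_
  congr 3
  funext j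
  rw [Combinatorics.Line.coe_apply]
  cases hj : l.idxFun j <;> simp

/-- The partite construction, iterated over a finite set of places `a`. -/
theorem exists_iterated_power (κ : Type) [Finite κ] [Nonempty κ] (relA : A → A → Option T)
    (Inv : PartiteSystem N T → Prop) (P : PartiteSystem N T) (hP : Inv P) (s : Set (A → N))
    (hs : s.Finite) (hinj : ∀ a ∈ s, Function.Injective a)
    (hstep : ∀ a ∈ s, ∀ D, Inv D → ∀ (ι : Type) [Finite ι] [Nonempty ι], Inv (D.power relA a ι)) :
    ∃ D, Inv D ∧ ∀ χ : (A → D.V) → κ, ∃ f, P.IsEmbedding D f ∧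
      ∀ a ∈ s, ∃ c, ∀ e, P.IsOver relA a e → χ (f ∘ e) = c := by
  induction s, hs using Set.Finite.induction_on with
  | empty => exact ⟨P, hP, fun χ => ⟨id, ⟨fun _ => rfl, fun _ _ => rfl⟩, by simp⟩⟩
  | @insert a s _ _ ih =>
    obtain ⟨D, hD, h⟩ := ih (fun a' ha' => hinj a' (.inr ha')) fun a' ha' => hstep a' (.inr ha')
    obtain ⟨ι, _, hι⟩ := exists_power κ D relA (hinj a (.inl rfl))
    -- `ι` is nonempty because lines have active coordinates; any colouring serves to extract this.
    obtain ⟨-, hne, -⟩ := hι fun _ => Classical.arbitrary κ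
    refine ⟨D.power relA a ι, hstep a (.inl rfl) D hD ι, fun χ => ?_⟩
    -- The last place is settled first: `g` makes the colour constant over `a` on all of `D`, hence
    -- on every copy of `P` found there for the pulled-back colouring.
    obtain ⟨g, -, hg, c, hc⟩ := hι χ
    obtain ⟨f, hf, hfs⟩ := h fun e => χ (g ∘ e)
    refine ⟨g ∘ f, ⟨fun x => (hg.proj _).trans (hf.proj x),
      fun x y => (hg.rel _ _).trans (hf.rel x y)⟩, ?_⟩
    rintro a' (rfl | ha')
    · exact ⟨c, fun e he => hc (f ∘ e) ⟨fun x => (hf.proj _).trans (he.1 x),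
        fun x y => (hf.rel _ _).trans (he.2 x y)⟩⟩
    · exact hfs a' ha'

open Classical in
/-- The disjoint union of copies of the structure `relB`, one over every map in `S`. -/
noncomputable def copies [Finite B] [Finite N] (relB : B → B → Option T) (S : Set (B → N)) :
    PartiteSystem N T where
  V := S × B
  finite := inferInstance
  proj p := p.1.1 p.2
  rel p q := if p.1 = q.1 then relB p.2 q.2 else none

/-- The partite construction turns an arrow in the index set into an arrow in a partite system. -/
theorem exists_arrow (κ : Type) [Finite κ] [Nonempty κ] [Finite B] [Finite N]
    (relA : A → A → Option T) (relB : B → B → Option T) (SA : Set (A → N)) (SB : Set (B → N))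
    (E : Set (A → B)) (hE : ∀ e ∈ E, ∀ x y, relB (e x) (e y) = relA x y)
    (hcomp : ∀ b ∈ SB, ∀ e ∈ E, b ∘ e ∈ SA) (hinj : ∀ a ∈ SA, Function.Injective a)
    (hbase : ∀ χ : (A → N) → κ, ∃ b ∈ SB, ∃ c, ∀ e ∈ E, χ (b ∘ e) = c)
    (Inv : PartiteSystem N T → Prop) (hcopies : Inv (copies relB SB))
    (hstep : ∀ a ∈ SA, ∀ D, Inv D → ∀ (ι : Type) [Finite ι] [Nonempty ι],
      Inv (D.power relA a ι)) :
    ∃ D, Inv D ∧ ∀ χ : (A → D.V) → κ, ∃ f : B → D.V, (∀ x y, D.rel (f x) (f y) = relB x y) ∧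
      D.proj ∘ f ∈ SB ∧ ∃ c, ∀ e ∈ E, χ (f ∘ e) = c := by
  classical
  obtain ⟨D, hD, h⟩ := exists_iterated_power κ relA Inv (copies relB SB) hcopies SA
    (Set.toFinite _) hinj hstep
  refine ⟨D, hD, fun χ => ?_⟩
  obtain ⟨f, hf, hfc⟩ := h χ
  -- On places in `SA` the colour is now a function of the place, that is, a colouring of the base.
  choose! col hcol using hfc
  obtain ⟨b, hb, c, hc⟩ := hbase col
  refine ⟨fun x => f (⟨b, hb⟩, x), fun x y => ?_, ?_, c, fun e he => ?_⟩
  · exact (hf.rel _ _).trans (by simp [copies])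
  · convert! hb using 1
    funext x
    exact hf.proj _
  · rw [← hc e he]
    exact hcol _ (hcomp b hb e he) (fun x => (⟨b, hb⟩, e x))
      ⟨fun x => rfl, fun x y => by simp [copies, hE e he]⟩

end PartiteSystem

end Partite

end BowtieFree

namespace BowtieFree

/-! ### Control of cliques -/

namespace PartiteSystem

variable {N T A B : Type}

/-- Related vertices of `D` are related as their projections in `relN`, and the cliques of `D`
project injectively to members of `F`. -/
structure IsCovered (D : PartiteSystem N T) (relN : N → N → Option T) (F : Set (Set N)) : Prop where
  diag : ∀ x, D.rel x x ≠ none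
  symm : ∀ x y, D.rel x y ≠ none → D.rel y x ≠ none
  eq_rel : ∀ x y, D.rel x y ≠ none → D.rel x y = relN (D.proj x) (D.proj y)
  injective : ∀ x y, D.rel x y ≠ none → D.proj x = D.proj y → x = y
  clique : ∀ S : Set D.V, S.Nonempty → (∀ x ∈ S, ∀ y ∈ S, D.rel x y ≠ none) →
    ∃ s ∈ F, D.proj '' S ⊆ s

section

variable {D : PartiteSystem N T} {relN : N → N → Option T} {F : Set (Set N)}
  {relA : A → A → Option T} {a : A → N} {ι : Type}

/-- Two parts determine the only type other than `none` between them, so coordinates of two tuples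
can deviate from `relA` only by being unrelated. -/
theorem IsCovered.rel_eq (hD : D.IsCovered relN F) (haR : ∀ x y, relA x y = relN (a x) (a y))
    {p q : A × (ι → D.V)} (hp : ∀ j, D.proj (p.2 j) = a p.1) (hq : ∀ j, D.proj (q.2 j) = a q.1)
    {j : ι} (h : D.rel (p.2 j) (q.2 j) ≠ none) : D.rel (p.2 j) (q.2 j) = relA p.1 q.1 := by
  rw [hD.eq_rel _ _ h, hp, hq, haR]

/-- Two tuples in the power are related if and only if they are related in all coordinates. -/
theorem IsCovered.powerRel_inl (hD : D.IsCovered relN F)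
    (haR : ∀ x y, relA x y = relN (a x) (a y)) [Nonempty ι]
    (p q : {p : A × (ι → D.V) // ∀ j, D.proj (p.2 j) = a p.1}) :
    D.powerRel relA a ι (.inl p) (.inl q) ≠ none ↔ ∀ j, D.rel (p.1.2 j) (q.1.2 j) ≠ none := by
  rw [powerRel]
  constructor
  · intro h
    have hall : ∀ j, D.rel (p.1.2 j) (q.1.2 j) = relA p.1.1 q.1.1 := by
      unfold select at h
      split_ifs at h with h'
      · exact absurd (hD.rel_eq haR p.2 q.2 h) h'.choose_spec
      · simpa using h'
    rw [select_eq_self hall] at h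
    intro j
    rwa [hall j]
  · intro h
    rw [select_eq_self fun j => hD.rel_eq haR p.2 q.2 (h j)]
    obtain ⟨j⟩ := ‹Nonempty ι›
    rw [← hD.rel_eq haR p.2 q.2 (h j)]
    exact h j

/-- This is the freeness of the amalgamation: every relation involving a vertex outside the parts
over `a` comes from a single line copy of `D`. -/
theorem powerRel_cases {u w : D.PowerVertex relA a ι} (h : D.powerRel relA a ι u w ≠ none) :
    (∃ p q, u = .inl p ∧ w = .inl q) ∨
      ∃ l v v', u = D.lineMap relA a l v ∧ w = D.lineMap relA a l v' := by
  have key : D.lineRel relA a ι u w ≠ none →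
      ∃ l v v', u = D.lineMap relA a l v ∧ w = D.lineMap relA a l v' := by
    intro h
    unfold lineRel at h
    split_ifs at h with h'
    · obtain ⟨⟨l, v, v'⟩, h₁, h₂⟩ := h'
      exact ⟨l, v, v', h₁, h₂⟩
    · exact absurd rfl h
  cases u with
  | inl p =>
    cases w with
    | inl q => exact .inl ⟨p, q, rfl, rfl⟩
    | inr q => exact .inr (key (by simpa only [powerRel] using h))
  | inr p => exact .inr (key (by simpa only [powerRel] using h))

theorem exists_lineMap_eq_inr (q : Combinatorics.Line {e : A → D.V // D.IsOver relA a e} ι ×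
    {v : D.V // ¬ ∃ x, a x = D.proj v}) : D.lineMap relA a q.1 q.2.1 = .inr q :=
  lineMap_of_not q.1 q.2.2

/-- Powers of covered systems are covered. -/
theorem IsCovered.power [Finite A] [Finite ι] [Nonempty ι] (hD : D.IsCovered relN F)
    (ha : Function.Injective a) (haR : ∀ x y, relA x y = relN (a x) (a y)) :
    (D.power relA a ι).IsCovered relN F where
  diag u := by
    cases u with
    | inl p => exact (hD.powerRel_inl haR p p).2 fun j => hD.diag _
    | inr q =>
      rw [← exists_lineMap_eq_inr q, (isEmbedding_lineMap ha q.1).rel]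
      exact hD.diag _
  symm u w h := by
    rcases powerRel_cases h with ⟨p, q, rfl, rfl⟩ | ⟨l, v, v', rfl, rfl⟩
    · exact (hD.powerRel_inl haR q p).2 fun j => hD.symm _ _ ((hD.powerRel_inl haR p q).1 h j)
    · rw [(isEmbedding_lineMap ha l).rel] at h ⊢
      exact hD.symm _ _ h
  eq_rel u w h := by
    rcases powerRel_cases h with ⟨p, q, rfl, rfl⟩ | ⟨l, v, v', rfl, rfl⟩
    · have h' := (hD.powerRel_inl haR p q).1 h
      exact (select_eq_self fun j => hD.rel_eq haR p.2 q.2 (h' j)).trans (haR _ _)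
    · rw [(isEmbedding_lineMap ha l).rel] at h ⊢
      rw [(isEmbedding_lineMap ha l).proj, (isEmbedding_lineMap ha l).proj]
      exact hD.eq_rel _ _ h
  injective u w h hp := by
    rcases powerRel_cases h with ⟨p, q, rfl, rfl⟩ | ⟨l, v, v', rfl, rfl⟩
    · have h' := (hD.powerRel_inl haR p q).1 h
      have hpq : p.1.1 = q.1.1 := ha hp
      refine congrArg Sum.inl (Subtype.ext (Prod.ext hpq (funext fun j => ?_)))
      exact hD.injective _ _ (h' j) (by rw [p.2, q.2, hpq])
    · rw [(isEmbedding_lineMap ha l).rel] at h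
      rw [(isEmbedding_lineMap ha l).proj, (isEmbedding_lineMap ha l).proj] at hp
      rw [hD.injective _ _ h hp]
  clique S hS h := by
    by_cases hout : ∃ q, (Sum.inr q : D.PowerVertex relA a ι) ∈ S
    · obtain ⟨q, hq⟩ := hout
      have hsub : ∀ w ∈ S, ∃ v, w = D.lineMap relA a q.1 v := by
        intro w hw
        have hqw : D.powerRel relA a ι (.inr q) w ≠ none := h _ hq w hw
        rcases powerRel_cases hqw with ⟨p, q', h', -⟩ | ⟨l, v, v', h₁, h₂⟩
        · cases h'
        · rw [← eq_of_lineMap_eq_inr h₁.symm]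
          exact ⟨v', h₂⟩
      obtain ⟨s, hs, hsS⟩ := hD.clique {v | D.lineMap relA a q.1 v ∈ S}
        ⟨q.2.1, by simpa [exists_lineMap_eq_inr q] using hq⟩ fun v hv w hw => by
          rw [← (isEmbedding_lineMap ha q.1).rel]
          exact h _ hv _ hw
      refine ⟨s, hs, ?_⟩
      rintro _ ⟨w, hw, rfl⟩
      obtain ⟨v, rfl⟩ := hsub w hw
      rw [(isEmbedding_lineMap ha q.1).proj]
      exact hsS ⟨v, hw, rfl⟩
    -- The clique consists of tuples; its `j`-th coordinates form a clique of `D` with the same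
    -- projections.
    · obtain ⟨j⟩ := ‹Nonempty ι›
      have hin : ∀ u ∈ S, ∃ p, u = .inl p := by
        rintro (p | q) hu
        · exact ⟨p, rfl⟩
        · exact absurd ⟨q, hu⟩ hout
      obtain ⟨s, hs, hsS⟩ := hD.clique
        {v | ∃ p : {p : A × (ι → D.V) // ∀ j, D.proj (p.2 j) = a p.1},
          (Sum.inl p : D.PowerVertex relA a ι) ∈ S ∧ p.1.2 j = v} (by
          obtain ⟨u, hu⟩ := hS
          obtain ⟨p, rfl⟩ := hin u hu
          exact ⟨_, p, hu, rfl⟩) (by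
          rintro _ ⟨p, hp, rfl⟩ _ ⟨q, hq, rfl⟩
          have : Nonempty ι := ⟨j⟩
          exact (hD.powerRel_inl haR p q).1 (h _ hp _ hq) j)
      refine ⟨s, hs, ?_⟩
      rintro _ ⟨u, hu, rfl⟩
      obtain ⟨p, rfl⟩ := hin u hu
      exact hsS ⟨_, ⟨p, hu, rfl⟩, p.2 j⟩

/-- Disjoint unions of copies are covered by the copies. -/
theorem isCovered_copies [Finite B] [Finite N] {relB : B → B → Option T} {S : Set (B → N)}
    (hdiag : ∀ x, relB x x ≠ none) (hsymm : ∀ x y, relB x y ≠ none → relB y x ≠ none)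
    (hinj : ∀ b ∈ S, Function.Injective b)
    (hrel : ∀ b ∈ S, ∀ x y, relN (b x) (b y) = relB x y) :
    (copies relB S).IsCovered relN {s | ∃ b ∈ S, s = Set.range b} := by
  classical
  have key : ∀ p q : S × B, (copies relB S).rel p q ≠ none →
      p.1 = q.1 ∧ (copies relB S).rel p q = relB p.2 q.2 := by
    intro p q h
    by_cases hpq : p.1 = q.1
    · exact ⟨hpq, if_pos hpq⟩
    · exact absurd (if_neg hpq) h
  have hpos : ∀ p q : S × B, p.1 = q.1 → (copies relB S).rel p q = relB p.2 q.2 :=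
    fun p q h => if_pos h
  refine ⟨fun p => ?_, fun p q h => ?_, fun p q h => ?_, fun p q h hpq => ?_, fun K hK h => ?_⟩
  · rw [hpos p p rfl]
    exact hdiag _
  · obtain ⟨h₁, h₂⟩ := key p q h
    rw [hpos q p h₁.symm]
    rw [h₂] at h
    exact hsymm _ _ h
  · obtain ⟨h₁, h₂⟩ := key p q h
    rw [h₂, ← hrel p.1 p.1.2]
    change relN (p.1.1 p.2) (p.1.1 q.2) = relN (p.1.1 p.2) (q.1.1 q.2)
    rw [h₁]
  · obtain ⟨h₁, -⟩ := key p q h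
    refine Prod.ext h₁ (hinj _ p.1.2 ?_)
    change p.1.1 p.2 = q.1.1 q.2 at hpq
    rw [hpq, h₁]
  · obtain ⟨p, hp⟩ := hK
    refine ⟨Set.range p.1.1, ⟨p.1.1, p.1.2, rfl⟩, ?_⟩
    rintro _ ⟨q, hq, rfl⟩
    refine ⟨q.2, ?_⟩
    rw [(key p q (h p hp q hq)).1]
    rfl

end

/-- The Ramsey property for ordered structures with free amalgamation: there is a structure on `V`,
with a map `height` to a linear order and a map `proj` whose restrictions to cliques are injective
and factor through copies of `B`, such that every colouring of maps `A → V` is constant on the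
copies of `A` in some copy of `B`. -/
theorem exists_free_arrow (κ : Type) [Finite κ] [Nonempty κ] [Finite A] [Finite B]
    [LinearOrder A] [LinearOrder B] (relA : A → A → Option T) (relB : B → B → Option T)
    (hdiag : ∀ x, relB x x ≠ none) (hsymm : ∀ x y, relB x y ≠ none → relB y x ≠ none) :
    ∃ (n : ℕ) (N : Type) (relN : N → N → Option T) (height : N → Fin n) (D : PartiteSystem N T),
      D.IsCovered relN {s | ∃ b : B → N, ((∀ x y, relN (b x) (b y) = relB x y) ∧
        StrictMono (height ∘ b)) ∧ s = Set.range b} ∧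
      ∀ χ : (A → D.V) → κ, ∃ f : B → D.V, (∀ x y, D.rel (f x) (f y) = relB x y) ∧
        StrictMono (height ∘ D.proj ∘ f) ∧
        ∃ c, ∀ e : A → B, StrictMono e → (∀ x y, relB (e x) (e y) = relA x y) →
          χ (f ∘ e) = c := by
  obtain ⟨n, hn⟩ := ramsey_strictMono κ A B
  let E : Set (A → B) := {e | StrictMono e ∧ ∀ x y, relB (e x) (e y) = relA x y}
  -- The first run has no invariant: `Fin n` carries no relations from which those of the system
  -- could be lifted.
  obtain ⟨C, -, hC⟩ := exists_arrow (N := Fin n) κ relA relB {a | StrictMono a} {b | StrictMono b} E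
    (fun e he => he.2) (fun b hb e he => StrictMono.comp hb he.1)
    (fun a ha => StrictMono.injective ha)
    (fun χ => by
      obtain ⟨b, hb, c, hc⟩ := hn χ
      exact ⟨b, hb, c, fun e he => hc e he.1⟩) (fun _ => True) trivial
    (fun _ _ _ _ _ _ _ => trivial)
  let SA : Set (A → C.V) := {a | (∀ x y, C.rel (a x) (a y) = relA x y) ∧ StrictMono (C.proj ∘ a)}
  let SB : Set (B → C.V) := {b | (∀ x y, C.rel (b x) (b y) = relB x y) ∧ StrictMono (C.proj ∘ b)}
  obtain ⟨D, hD, hDχ⟩ := exists_arrow κ relA relB SA SB E (fun e he => he.2)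
    (fun b hb e he => ⟨fun x y => (hb.1 _ _).trans (he.2 x y), hb.2.comp he.1⟩)
    (fun a ha => ha.2.injective.of_comp)
    (fun χ => by
      obtain ⟨f, hf, hmono, c, hc⟩ := hC χ
      exact ⟨f, ⟨hf, hmono⟩, c, hc⟩)
    (fun D => D.IsCovered C.rel {s | ∃ b ∈ SB, s = Set.range b})
    (isCovered_copies hdiag hsymm (fun b hb => hb.2.injective.of_comp) fun b hb => hb.1)
    (fun a ha D hD ι _ _ => hD.power ha.2.injective.of_comp fun x y => (ha.1 x y).symm)
  refine ⟨n, C.V, C.rel, C.proj, D, hD, fun χ => ?_⟩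
  obtain ⟨f, hf, hfS, c, hc⟩ := hDχ χ
  exact ⟨f, hf, hfS.2, c, fun e he heR => hc e ⟨he, heR⟩⟩

end PartiteSystem

end BowtieFree

namespace BowtieFree

/-! ### `L•`-structures as systems of types of pairs -/

section Translation

/-- The vertex `x` is in the unary relation `r`. -/
def UnRel (A : RedStr) (r : RedRel 1) (x : A) : Prop :=
  Language.Structure.RelMap (L := redLang) (n := 1) r ![x]

theorem comp_vec_one {M N : Type} (f : M → N) (x : M) : f ∘ ![x] = ![f x] := by
  ext i
  fin_cases i
  rfl

theorem comp_vec_two {M N : Type} (f : M → N) (x y : M) : f ∘ ![x, y] = ![f x, f y] := by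
  ext i
  fin_cases i <;> rfl

/-- Embeddings of `L•`-structures, in terms of unary and binary relations. -/
def embeddingOfRel {A C : RedStr} (f : A → C) (hf : Function.Injective f)
    (h₁ : ∀ r x, UnRel C r (f x) ↔ UnRel A r x)
    (h₂ : ∀ r x y, BinRel C r (f x) (f y) ↔ BinRel A r x y) : A ↪[redLang] C where
  toFun := f
  inj' := hf
  map_fun' := fun F => Empty.elim F
  map_rel' := by
    have key₁ : ∀ (r : RedRel 1) (x : Fin 1 → A),
        Language.Structure.RelMap (L := redLang) (M := C) (n := 1) r (f ∘ x) ↔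
          Language.Structure.RelMap (L := redLang) (n := 1) r x := by
      intro r x
      have hx : x = ![x 0] := List.ofFn_inj.1 rfl
      rw [hx, comp_vec_one]
      exact h₁ r (x 0)
    have key₂ : ∀ (r : RedRel 2) (x : Fin 2 → A),
        Language.Structure.RelMap (L := redLang) (M := C) (n := 2) r (f ∘ x) ↔
          Language.Structure.RelMap (L := redLang) (n := 2) r x := by
      intro r x
      have hx : x = ![x 0, x 1] := List.ofFn_inj.1 rfl
      rw [hx, comp_vec_two]
      exact h₂ r (x 0) (x 1)
    intro n r x
    cases r with
    | left => exact key₁ .left x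
    | first => exact key₁ .first x
    | le => exact key₂ .le x
    | edge₀ => exact key₂ .edge₀ x
    | edge₁ => exact key₂ .edge₁ x
    | typ t => exact key₂ (.typ t) x

theorem unRel_embedding {A C : RedStr} (f : A ↪[redLang] C) (r : RedRel 1) (x : A) :
    UnRel C r (f x) ↔ UnRel A r x := by
  have := f.map_rel (n := 1) r ![x]
  rwa [comp_vec_one] at this

theorem binRel_embedding {A C : RedStr} (f : A ↪[redLang] C) (r : RedRel 2) (x y : A) :
    BinRel C r (f x) (f y) ↔ BinRel A r x y := by
  have := f.map_rel (n := 2) r ![x, y]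
  rwa [comp_vec_two] at this

/-- The type of a pair: the unary relations of the first vertex, and the binary relations other than
the order. -/
abbrev RelType : Type := Set (RedRel 1) × Set (RedRel 2)

/-- The unary relation `r` holds for the first vertex of a pair of type `o`. -/
def HasUnRel (r : RedRel 1) (o : Option RelType) : Prop := ∃ t ∈ o, r ∈ t.1

/-- The binary relation `r` holds for a pair of type `o`. -/
def HasBinRel (r : RedRel 2) (o : Option RelType) : Prop := ∃ t ∈ o, r ∈ t.2

open Classical in
/-- The type of the pair `(x, y)`, or `none` if `x` and `y` are distinct and in no common relation
other than the order. -/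
noncomputable def pairRel (A : RedStr) (x y : A) : Option RelType :=
  if x = y ∨ ∃ r, r ≠ .le ∧ (BinRel A r x y ∨ BinRel A r y x) then
    some ({r | UnRel A r x}, {r | r ≠ .le ∧ BinRel A r x y}) else none

theorem pairRel_ne_none {A : RedStr} {x y : A} :
    pairRel A x y ≠ none ↔ x = y ∨ ∃ r, r ≠ .le ∧ (BinRel A r x y ∨ BinRel A r y x) := by
  rw [pairRel]
  split_ifs with h <;> simp [h]

theorem pairRel_self_ne_none {A : RedStr} (x : A) : pairRel A x x ≠ none :=
  pairRel_ne_none.2 (.inl rfl)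

theorem pairRel_symm {A : RedStr} (x y : A) (h : pairRel A x y ≠ none) : pairRel A y x ≠ none := by
  rw [pairRel_ne_none] at h ⊢
  rcases h with rfl | ⟨r, hr, h⟩
  · exact .inl rfl
  · exact .inr ⟨r, hr, h.symm⟩

theorem mem_pairRel_fst {A : RedStr} {x : A} {r : RedRel 1} :
    HasUnRel r (pairRel A x x) ↔ UnRel A r x := by
  simp [pairRel, HasUnRel]

theorem mem_pairRel_snd {A : RedStr} {x y : A} {r : RedRel 2} (hr : r ≠ .le) :
    HasBinRel r (pairRel A x y) ↔ BinRel A r x y := by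
  rw [pairRel]
  split_ifs with h
  · simp [HasBinRel, hr]
  · have : ¬ BinRel A r x y := fun h' => h (.inr ⟨r, hr, .inl h'⟩)
    simp [HasBinRel, this]

theorem pairRel_embedding {A C : RedStr} (f : A ↪[redLang] C) (x y : A) :
    pairRel C (f x) (f y) = pairRel A x y := by
  have h : (f x = f y ∨ ∃ r, r ≠ .le ∧ (BinRel C r (f x) (f y) ∨ BinRel C r (f y) (f x))) ↔
      (x = y ∨ ∃ r, r ≠ .le ∧ (BinRel A r x y ∨ BinRel A r y x)) := by
    simp only [binRel_embedding f, f.injective.eq_iff]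
  simp only [pairRel, unRel_embedding f, binRel_embedding f]
  classical exact if_congr h rfl rfl

/-- The `L•`-structure with the given types of pairs and the given order. -/
@[reducible]
def systemStructure {V : Type} (rel : V → V → Option RelType) (le : V → V → Prop) :
    redLang.Structure V where
  funMap := fun f => Empty.elim f
  RelMap := fun {_} r => match r with
    | RedRel.left => fun x => HasUnRel .left (rel (x 0) (x 0))
    | RedRel.first => fun x => HasUnRel .first (rel (x 0) (x 0))
    | RedRel.le => fun x => le (x 0) (x 1)
    | RedRel.edge₀ => fun x => HasBinRel .edge₀ (rel (x 0) (x 1))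
    | RedRel.edge₁ => fun x => HasBinRel .edge₁ (rel (x 0) (x 1))
    | RedRel.typ t' => fun x => HasBinRel (.typ t') (rel (x 0) (x 1))

/-- The bundled version of `systemStructure`. -/
abbrev systemStr {V : Type} (rel : V → V → Option RelType) (le : V → V → Prop) : RedStr :=
  ⟨V, systemStructure rel le⟩

section

variable {V : Type} {rel : V → V → Option RelType} {le : V → V → Prop}

theorem unRel_systemStr (r : RedRel 1) (v : V) :
    UnRel (systemStr rel le) r v ↔ HasUnRel r (rel v v) := by
  cases r <;> exact Iff.rfl

theorem binRel_systemStr {r : RedRel 2} (hr : r ≠ .le) (v w : V) :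
    BinRel (systemStr rel le) r v w ↔ HasBinRel r (rel v w) := by
  cases r with
  | le => exact absurd rfl hr
  | edge₀ => exact Iff.rfl
  | edge₁ => exact Iff.rfl
  | typ t => exact Iff.rfl

end

/-- The linear order of an ordered structure. -/
@[reducible]
noncomputable def IsOrdered.linearOrder {A : RedStr} (h : IsOrdered A) : LinearOrder A where
  le := BinRel A .le
  le_refl := h.refl
  le_trans := h.trans
  le_antisymm := h.antisymm
  le_total := h.total
  toDecidableLE := Classical.decRel _

open Classical in
/-- The number of the block of the order in which a vertex lies whose pair type with itself is
`o`: vertices in `L`, vertices in `1`, other vertices. -/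
noncomputable def block (o : Option RelType) : ℕ :=
  if HasUnRel .left o then 0 else if HasUnRel .first o then 1 else 2

/-- In admissible orders, the number of the block is monotone. -/
theorem IsAdmissiblyOrdered.block_le {A : RedStr} (h : IsAdmissiblyOrdered A) {x y : A}
    (hxy : Before A x y) : block (pairRel A x x) ≤ block (pairRel A y y) := by
  -- If `y` lay in an earlier block than `x`, admissibility would put `y` before `x`.
  have hyx : ¬ Before A y x := fun h' => hxy.2 (h.ordered.antisymm _ _ hxy.1 h'.1)
  have h₁ := h.left_first y x
  have h₂ := h.left_rest y x
  have h₃ := h.first_rest y x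
  change UnRel A .left y → UnRel A .first x → _ at h₁
  change UnRel A .left y → ¬ UnRel A .left x → ¬ UnRel A .first x → _ at h₂
  change UnRel A .first y → ¬ UnRel A .left x → ¬ UnRel A .first x → _ at h₃
  simp only [← mem_pairRel_fst] at h₁ h₂ h₃
  unfold block
  split_ifs <;> first | omega | tauto

/-- Structures in which the cliques embed in `B`, ordered by blocks first. -/
theorem IsAdmissiblyOrdered.of_block {B : RedStr} (hB : IsAdmissiblyOrdered B) {V K : Type}
    [LinearOrder K] {rel : V → V → Option RelType} {key : V → K}
    (hkey : Function.Injective key)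
    (hblock : ∀ v w, block (rel v v) < block (rel w w) → key v < key w)
    (hpt : ∀ v, ∃ x : B, rel v v = pairRel B x x) :
    IsAdmissiblyOrdered (systemStr rel fun v w => key v ≤ key w) := by
  have hleft : ∀ v : V, InLeft (systemStr rel fun v w => key v ≤ key w) v ↔
    HasUnRel .left (rel v v) := fun v => Iff.rfl
  have hfirst : ∀ v : V, InFirst (systemStr rel fun v w => key v ≤ key w) v ↔
    HasUnRel .first (rel v v) := fun v => Iff.rfl
  -- `L` and `1` are disjoint in B: a vertex in both would strictly precede itself.
  have hdisj : ∀ v : V, HasUnRel .left (rel v v) →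
      ¬ HasUnRel .first (rel v v) := by
    intro v
    obtain ⟨x, hx⟩ := hpt v
    rw [hx, mem_pairRel_fst, mem_pairRel_fst]
    exact fun h₁ h₂ => (hB.left_first x x h₁ h₂).2 rfl
  have hbefore : ∀ v w, block (rel v v) < block (rel w w) →
      Before (systemStr rel fun v w => key v ≤ key w) v w := fun v w h =>
    ⟨(hblock v w h).le, fun hvw => (hblock v w h).ne (by rw [hvw])⟩
  refine ⟨⟨fun v => le_refl (key v), fun v w h h' => hkey (le_antisymm h h'),
    fun u v w h h' => le_trans (α := K) h h', fun v w => le_total (key v) (key w)⟩,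
    fun v w hv hw => hbefore v w ?_, fun v w hv hw hw' => hbefore v w ?_,
    fun v w hv hw hw' => hbefore v w ?_⟩
  · rw [hleft] at hv
    rw [hfirst] at hw
    simp only [block, if_pos hv, if_pos hw, if_neg fun h => hdisj w h hw]
    omega
  · rw [hleft] at hv hw
    rw [hfirst] at hw'
    simp only [block, if_pos hv, if_neg hw, if_neg hw']
    omega
  · rw [hleft] at hw
    rw [hfirst] at hv hw'
    simp only [block, if_pos hv, if_neg hw, if_neg hw', if_neg fun h => hdisj v h hv]
    omega

/-- A colour-preserving copy property of maps gives the arrow between structures. -/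
theorem arrows_of_maps {A B C : RedStr} {k : ℕ} [Nonempty (Fin k)]
    (h : ∀ χ : (A → C) → Fin k, ∃ f : B ↪[redLang] C, ∃ c, ∀ e : A ↪[redLang] B,
      χ (f ∘ e) = c) : Arrows C B A k := by
  classical
  intro χ
  -- A map gets the colour of the copy of A that is its range, and a default colour if its range is
  -- no such copy.
  obtain ⟨f, c, hc⟩ := h fun e =>
    if h : ∃ A' : {A' : redLang.Substructure C // Nonempty (A ≃[redLang] A')},
      (A'.1 : Set C) = Set.range e then χ h.choose else Classical.arbitrary _
  refine ⟨f.toHom.range, ⟨f.equivRange⟩, c, fun A' hA' => ?_⟩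
  obtain ⟨g⟩ := A'.2
  have hmem : ∀ x : A, ∃ y : B, f y = (g x : C) := fun x => by
    simpa using hA' (g x).2
  choose e he using hmem
  have hinj : Function.Injective e := fun x y hxy => by
    apply g.injective
    rw [← Subtype.coe_inj, ← he, ← he, hxy]
  let i : A ↪[redLang] C := A'.1.subtype.comp g.toEmbedding
  have hi : ∀ x, f (e x) = i x := he
  let E : A ↪[redLang] B := embeddingOfRel e hinj
    (fun r x => by rw [← unRel_embedding f, hi, unRel_embedding i])
    (fun r x y => by rw [← binRel_embedding f, hi, hi, binRel_embedding i])
  have key := hc E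
  have hrange : (A'.1 : Set C) = Set.range (f ∘ E) := by
    ext z
    constructor
    · intro hz
      obtain ⟨x, hx⟩ := g.surjective ⟨z, hz⟩
      exact ⟨x, (he x).trans (by rw [hx])⟩
    · rintro ⟨x, rfl⟩
      change f (e x) ∈ A'.1
      rw [he]
      exact (g x).2
  have hex : ∃ A' : {A' : redLang.Substructure C // Nonempty (A ≃[redLang] A')},
      (A'.1 : Set C) = Set.range (f ∘ E) := ⟨A', hrange⟩
  rw [dif_pos hex] at key
  have heq : hex.choose = A' :=
    Subtype.ext (SetLike.coe_injective (hex.choose_spec.trans hrange.symm))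
  rwa [heq] at key

end Translation

/-! ### The Ramsey theorem for classes with complete forbidden structures -/

/-- `Forb_{L•}(S)` is a Ramsey class if the structures in `S` are complete. -/
theorem isRamseyClass_forb {S : Set RedStr} (hS : ∀ F ∈ S, IsComplete F) :
    IsRamseyClass (forb S) := by
  rintro A ⟨hAfin, hA, -⟩ B ⟨hBfin, hB, hBS⟩ k hk
  have : Nonempty (Fin k) := ⟨⟨0, hk⟩⟩
  let _ := hA.ordered.linearOrder
  let _ := hB.ordered.linearOrder
  obtain ⟨n, N, relN, height, D, hD, hDχ⟩ := PartiteSystem.exists_free_arrow (Fin k)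
    (pairRel A) (pairRel B) pairRel_self_ne_none pairRel_symm
  obtain ⟨m, ⟨enum⟩⟩ := Finite.exists_equiv_fin D.V
  -- The block comes first to make the order admissible; the height orders the copies of B, and the
  -- enumeration breaks ties.
  let key : D.V → ℕ ×ₗ (Fin n ×ₗ Fin m) := fun v =>
    toLex (block (D.rel v v), toLex (height (D.proj v), enum v))
  have hkey : Function.Injective key := fun v w h => by
    have := congrArg (fun p => (ofLex (ofLex p).2).2) h
    exact enum.injective this
  have hblock : ∀ v w, block (D.rel v v) < block (D.rel w w) → key v < key w :=
    fun v w h => Prod.Lex.toLex_lt_toLex.2 (.inl h)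
  -- Copies of `B` in the old order are copies of `B` in the new one.
  have hmono : ∀ (v w : D.V) (x y : B), D.rel v v = pairRel B x x → D.rel w w = pairRel B y y →
      x < y → height (D.proj v) < height (D.proj w) → key v < key w := by
    intro v w x y hv hw hxy hh
    have hle := hB.block_le (x := x) (y := y) ⟨hxy.le, hxy.ne⟩
    rw [← hv, ← hw] at hle
    rcases hle.lt_or_eq with hlt | heq
    · exact hblock v w hlt
    · exact Prod.Lex.toLex_lt_toLex.2 (.inr ⟨heq, Prod.Lex.toLex_lt_toLex.2 (.inl hh)⟩)
  let C : RedStr := systemStr D.rel fun v w => key v ≤ key w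
  have hC₁ : ∀ r (v : D.V), UnRel C r v ↔ HasUnRel r (D.rel v v) := unRel_systemStr
  have hC₂ : ∀ r, r ≠ .le → ∀ v w : D.V, BinRel C r v w ↔ HasBinRel r (D.rel v w) :=
    fun r hr => binRel_systemStr hr
  have hpt : ∀ v, ∃ x : B, D.rel v v = pairRel B x x := by
    intro v
    obtain ⟨_, ⟨b, ⟨hb, -⟩, rfl⟩, hsub⟩ := hD.clique {v} ⟨v, rfl⟩ (by
      rintro _ rfl _ rfl
      exact hD.diag _)
    obtain ⟨x, hx⟩ := hsub ⟨v, rfl, rfl⟩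
    exact ⟨x, by rw [hD.eq_rel v v (hD.diag v), ← hx, hb]⟩
  refine ⟨C, ⟨D.finite, hB.of_block hkey hblock hpt, fun F hF => ⟨fun φ => ?_⟩⟩, ?_⟩
  · suffices Nonempty (F ↪[redLang] B) from (hBS F hF).false this.some
    -- Only nonempty cliques are covered by copies of B, so an empty `F` is treated apart.
    rcases isEmpty_or_nonempty F with hempty | ⟨⟨x₀⟩⟩
    · exact ⟨embeddingOfRel (fun x => hempty.elim x) (fun x => hempty.elim x)
        (fun _ x => hempty.elim x) (fun _ x => hempty.elim x)⟩
    let ψ : F → D.V := φ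
    have hrel : ∀ x y, D.rel (ψ x) (ψ y) ≠ none := by
      intro x y
      by_cases hxy : x = y
      · rw [hxy]
        exact hD.diag _
      obtain ⟨r, hr, h⟩ := hS F hF x y hxy
      rw [← binRel_embedding φ, ← binRel_embedding φ r y x] at h
      rcases h.imp (hC₂ r hr _ _).1 (hC₂ r hr _ _).1 with ⟨t, ht, -⟩ | ⟨t, ht, -⟩
      · exact ne_of_eq_of_ne ht (Option.some_ne_none t)
      · exact hD.symm _ _ (ne_of_eq_of_ne ht (Option.some_ne_none t))
    obtain ⟨_, ⟨b, ⟨hb, hbmono⟩, rfl⟩, hsub⟩ := hD.clique (Set.range ψ) ⟨_, x₀, rfl⟩ (by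
      rintro _ ⟨x, rfl⟩ _ ⟨y, rfl⟩
      exact hrel x y)
    have hex : ∀ x, ∃ y, b y = D.proj (ψ x) := fun x => hsub ⟨_, ⟨x, rfl⟩, rfl⟩
    choose g hg using hex
    have hrelB : ∀ x y, D.rel (ψ x) (ψ y) = pairRel B (g x) (g y) := by
      intro x y
      rw [hD.eq_rel _ _ (hrel x y), ← hg, ← hg, hb]
    have hψ : Function.Injective ψ := φ.inj'
    have hginj : Function.Injective g := fun x y hxy =>
      hψ (hD.injective _ _ (hrel x y) (by rw [← hg, ← hg, hxy]))
    have hlt : ∀ x y, g x < g y → key (ψ x) < key (ψ y) := fun x y hxy =>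
      hmono _ _ _ _ (hrelB x x) (hrelB y y) hxy (by
        rw [← hg, ← hg]
        exact hbmono hxy)
    refine ⟨embeddingOfRel g hginj (fun r x => ?_) (fun r x y => ?_)⟩
    · rw [← unRel_embedding φ, ← mem_pairRel_fst, ← hrelB]
      exact (hC₁ r (ψ x)).symm
    · by_cases hr : r = .le
      · subst hr
        rw [← binRel_embedding φ]
        change g x ≤ g y ↔ key (ψ x) ≤ key (ψ y)
        rcases lt_trichotomy (g x) (g y) with h | h | h
        · exact iff_of_true h.le (hlt x y h).le
        · rw [hginj h]
          simp
        · exact iff_of_false h.not_ge (hlt y x h).not_ge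
      · rw [← binRel_embedding φ, ← mem_pairRel_snd hr, ← hrelB]
        exact (hC₂ r hr (ψ x) (ψ y)).symm
  · refine arrows_of_maps fun χ => ?_
    obtain ⟨f, hf, hfmono, c, hc⟩ := hDχ χ
    have hlt : ∀ x y, x < y → key (f x) < key (f y) := fun x y hxy =>
      hmono _ _ _ _ (hf x x) (hf y y) hxy (hfmono hxy)
    refine ⟨embeddingOfRel (C := C) f hfmono.injective.of_comp.of_comp (fun r x => ?_)
      (fun r x y => ?_), c, fun e => hc e ?_ (pairRel_embedding e)⟩
    · rw [hC₁, hf, mem_pairRel_fst]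
    · by_cases hr : r = .le
      · subst hr
        change key (f x) ≤ key (f y) ↔ x ≤ y
        rcases lt_trichotomy x y with h | h | h
        · exact iff_of_true (hlt x y h).le h.le
        · rw [h]
          simp
        · exact iff_of_false (hlt y x h).not_ge h.not_ge
      · rw [hC₂ r hr, hf, mem_pairRel_snd hr]
    · intro x y hxy
      exact lt_of_le_of_ne ((binRel_embedding e .le x y).2 hxy.le) (e.injective.ne hxy.ne)

end BowtieFree

theorem mainTheorem5 :
    BowtieFree.IsRamseyClass (BowtieFree.forb BowtieFree.triangles) :=
  BowtieFree.isRamseyClass_forb fun _ hF => hF.2.2.1
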